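/- There is an absolute constant $C>0$ such that the following holds. **Lipschitz MAB.** Let $(X,\mathcal D)$ be a nonempty metric space whose points are the arms. Each arm $x$ has a fixed reward distribution on $[0,1]$ with mean $\mu(x)$, and $|\mu(x)-\mu(y)|\le \mathcal D(x,y)$ for all $x,y\in X$. Assume that there is a finite set that contains all realized rewards of all arms. Each time an arm is played, its reward is a fresh independent sample from its distribution. Let $T\ge 2$ be the time horizon, let $\mu^*=\sup_{x}\mu(x)$ and $\Delta(x)=\mu^*-\mu(x)$, and let $R(T)=\mu^*T-\sum_{t=1}^T\mu(a_t)$ be the regret, where $a_t$ is the arm played in round $t$. **Zooming algorithm.** The algorithm knows $T$ and $\mathcal D$ and keeps a set $S$ of active arms, initially empty. Let $n_t(x)$ be the number of rounds before round $t$ in which $x$ was played, let $\mu_t(x)$ be the average reward of $x$ in these rounds ($0$ if there are none), and let $r_t(x)=\sqrt{2\log T/(n_t(x)+1)}$. In each round $t$: if some arm lies in none of the closed balls $\{y:\mathcal D(x,y)\le r_t(x)\}$, $x\in S$, then one such arm is added to $S$; after that, an arm $x\in S$ with the largest index $\mu_t(x)+2r_t(x)$ is played. The arm that is added, and the arm that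 is played in case of a tie, are chosen in an arbitrary way, as a deterministic function of the past observations. **Zooming dimension.** For $Y\subseteq X$ and $\varepsilon>0$ let $N_\varepsilon(Y)$ be the smallest number of subsets of $Y$, each of diameter at most $\varepsilon$, whose union is $Y$. For $r>0$ let $X_r=\{x\in X: r\le\Delta(x)<2r\}$. The zooming dimension with multiplier $c>0$ is $$\inf\{d\ge 0:\; N_{r/3}(X_r)\le c\,r^{-d}\ \text{ for all } r>0\}.$$ **Theorem.** For every such problem instance, every $T\ge2$, every choice of the deterministic rules for activation and ties, and every $c>0$ for which the zooming dimension $d$ with multiplier $c$ is finite, the zooming algorithm satisfies $$\mathbb E[R(T)]\;\le\; C\; T^{\frac{d+1}{d+2}}\,(c\log T)^{\frac1{d+2}} .$$ -/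

import Mathlib

open scoped ENNReal NNReal

noncomputable section

namespace LipMAB

/-- Expectation of a real-valued function under a discrete distribution. -/
def expect {α : Type*} (p : PMF α) (f : α → ℝ) : ℝ :=
  ∑' a, (p a).toReal * f a

/-- An instance of Lipschitz MAB on the metric space `X`: each arm has a (discrete) distribution of
rewards in `[0,1]`, and the mean reward is Lipschitz, with constant `1`, in the arm. -/
structure Problem (X : Type*) [MetricSpace X] where
  /-- the reward distribution of each arm -/
  reward : X → PMF ℝ
  reward_mem : ∀ x, (reward x).support ⊆ Set.Icc 0 1
  lipschitz : ∀ x y, |expect (reward x) id - expect (reward y) id| ≤ dist x y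

/-- Covering number of a set `Y` at scale `ε`: the smallest number of subsets of `Y`, each of
diameter at most `ε`, whose union is `Y` (infinite if finitely many do not suffice). -/
def coveringNumber {X : Type*} [MetricSpace X] (ε : ℝ) (Y : Set X) : ℕ∞ :=
  ⨅ (F : Finset (Set X))
    (_ : ⋃₀ (F : Set (Set X)) = Y ∧ ∀ A ∈ F, Metric.ediam A ≤ ENNReal.ofReal ε), (F.card : ℕ∞)

namespace Problem

variable {X : Type*} [MetricSpace X] (I : Problem X)

/-- Mean reward of an arm. -/
def mean (x : X) : ℝ := expect (I.reward x) id

/-- The best mean reward `μ*`, a supremum over all arms. -/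
def best : ℝ := ⨆ x, I.mean x

/-- The gap `Δ(x) = μ* - μ(x)`. -/
def gap (x : X) : ℝ := I.best - I.mean x

/-- The set `X_r` of arms whose gap is at least `r` and less than `2 r`. -/
def shell (r : ℝ) : Set X := {x | r ≤ I.gap x ∧ I.gap x < 2 * r}

/-- The zooming dimension with multiplier `c`: the infimum of the `d ≥ 0` such that
`N_{r/3}(X_r) ≤ c r^{-d}` for all `r > 0`. It is `∞` if there is no such `d`. -/
def zoomingDim (c : ℝ) : ℝ≥0∞ :=
  ⨅ (d : ℝ≥0)
    (_ : ∀ r : ℝ, 0 < r →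
      (coveringNumber (r / 3) (I.shell r) : ℝ≥0∞) ≤ ENNReal.ofReal (c * r ^ (-(d : ℝ)))),
    (d : ℝ≥0∞)

end Problem

/-- What the algorithm has observed so far: the pairs (arm played, realized reward) of the past
rounds, the most recent round first. -/
abbrev History (X : Type*) := List (X × ℝ)

section Rules

variable {X : Type*}

/-- The realized rewards of arm `x` in the rounds of the history in which it was played. -/
def samples (h : History X) (x : X) : List ℝ :=
  open Classical in (h.filter (fun p => p.1 = x)).map Prod.snd

/-- `n_t(x)`: how many times arm `x` has been played. -/
def numPlays (h : History X) (x : X) : ℕ := (samples h x).length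

/-- `μ_t(x)`: the average reward of arm `x` so far, and `0` if `x` has not been played yet. -/
def avgReward (h : History X) (x : X) : ℝ := (samples h x).sum / numPlays h x

/-- The confidence radius `r_t(x)`, for time horizon `T`. -/
def confRadius (T : ℕ) (h : History X) (x : X) : ℝ :=
  Real.sqrt (2 * Real.log T / (numPlays h x + 1))

/-- The index of arm `x`. -/
def index (T : ℕ) (h : History X) (x : X) : ℝ := avgReward h x + 2 * confRadius T h x

/-- The union of the confidence balls of the arms in `S`. -/
def covered [MetricSpace X] (T : ℕ) (h : History X) (S : Set X) : Set X :=
  ⋃ x ∈ S, Metric.closedBall x (confRadius T h x)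

/-- The activation rule: `S'` is a possible set of active arms in the round that follows the
history `h`, if `S` is the set of arms activated in earlier rounds. If some arm is not covered, one
such arm is activated; otherwise the set does not change. -/
def Activates [MetricSpace X] (T : ℕ) (h : History X) (S S' : Set X) : Prop :=
  (∃ y, y ∉ covered T h S ∧ S' = insert y S) ∨ (covered T h S = Set.univ ∧ S' = S)

end Rules

/-- A deterministic bandit algorithm that maintains a set of active arms. -/
structure Algorithm (X : Type*) where
  /-- the set of active arms in the round that follows a history, after the activation step -/
  active : History X → Set X
  /-- the arm played in the round that follows a history -/
  play : History X → X

namespace Algorithm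

variable {X : Type*}

/-- `A` is the zooming algorithm with time horizon `T`, with some way to choose the arm that is
activated and to break ties. -/
structure IsZooming [MetricSpace X] (A : Algorithm X) (T : ℕ) : Prop where
  activate_first : Activates T [] ∅ (A.active [])
  activate_next : ∀ (p : X × ℝ) (h : History X),
    Activates T (p :: h) (A.active h) (A.active (p :: h))
  play_active : ∀ h, A.play h ∈ A.active h
  play_max : ∀ h, ∀ y ∈ A.active h, index T h y ≤ index T h (A.play h)

/-- The distribution of the history of the first `t` rounds: in each round the reward is a fresh
independent sample from the reward distribution of the arm that is played. -/
def law [MetricSpace X] (A : Algorithm X) (I : Problem X) : ℕ → PMF (History X)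
  | 0 => PMF.pure []
  | t + 1 => (A.law I t).bind fun h => (I.reward (A.play h)).map fun v => (A.play h, v) :: h

end Algorithm

/-- Realized regret `R(T) = μ* T - ∑ μ(a_t)` of the arms `a_1, …, a_T` played in a history of `T`
rounds. -/
def Problem.regret {X : Type*} [MetricSpace X] (I : Problem X) (T : ℕ) (h : History X) : ℝ :=
  I.best * T - (h.map fun p => I.mean p.1).sum

/-- Expected regret `E[R(T)]` of an algorithm. -/
def Algorithm.expectedRegret {X : Type*} [MetricSpace X] (A : Algorithm X) (I : Problem X)
    (T : ℕ) : ℝ :=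
  expect (A.law I T) (I.regret T)

end LipMAB

end

/-! Call a history clean if every average has stayed within its confidence radius of the mean. Then
an arm is played only when its gap is at most three radii (`gap_play_le`), so `n(x) Δ(x)² ≤ 18 log
T` (`numPlays_mul_gap_sq_le`), and every gap is at most `√18` radii. A newly activated arm lies
outside the balls of the older ones, hence far from those of large gap (`lt_dist_of_mem_active`).
Active arms of similar gap are thus separated, and the zooming dimension bounds their number.
Summing over gap scales above `δ` gives `2δT + 72 c log T δ^{-(d+1)}`; the best `δ` balances the two
terms.

Cleanness cannot come from a union bound over `X`, which may be uncountable. Instead, `potential`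
adds up exponential supermartingales of the played arms only. Each round starts at most one of them,
at value 1, so the expected sum after `t` rounds is at most `t` (`expect_potential_le`).

The resulting failure probability is at most `4/√T`. With the trivial regret `T` this costs order
`√T`, too much when `c` is small. But finite zooming dimension also bounds every gap by `2B/√T`,
where `B` is the target rate (`gap_le_of_zoomingDim`), so failure costs only `8B`. -/

noncomputable section

namespace LipMAB

/-! ### Expectations under finitely supported distributions, and Hoeffding's lemma. -/

section Expectation

variable {α β : Type*}

theorem expect_eq_sum (p : PMF α) (f : α → ℝ) {s : Finset α} (hs : p.support ⊆ s) :
    expect p f = ∑ a ∈ s, (p a).toReal * f a := by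
  refine tsum_eq_sum fun a ha => ?_
  have : p a = 0 := by
    by_contra h
    exact ha (hs ((PMF.mem_support_iff p a).2 h))
  simp [this]

theorem sum_toReal_eq_one (p : PMF α) {s : Finset α} (hs : p.support ⊆ s) :
    ∑ a ∈ s, (p a).toReal = 1 := by
  rw [← ENNReal.toReal_sum fun a _ => p.apply_ne_top a]
  have : ∑ a ∈ s, p a = 1 := by
    rw [← p.tsum_coe]
    refine (tsum_eq_sum fun a ha => ?_).symm
    by_contra h
    exact ha (hs ((PMF.mem_support_iff p a).2 h))
  simp [this]

theorem expect_mono {p : PMF α} (hp : p.support.Finite) {f g : α → ℝ}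
    (h : ∀ a ∈ p.support, f a ≤ g a) : expect p f ≤ expect p g := by
  have hs : p.support ⊆ hp.toFinset := by simp
  rw [expect_eq_sum p f hs, expect_eq_sum p g hs]
  refine Finset.sum_le_sum fun a ha => ?_
  exact mul_le_mul_of_nonneg_left (h a (by simpa using ha)) ENNReal.toReal_nonneg

theorem expect_add {p : PMF α} (hp : p.support.Finite) (f g : α → ℝ) :
    expect p (fun a => f a + g a) = expect p f + expect p g := by
  have hs : p.support ⊆ hp.toFinset := by simp
  simp only [expect_eq_sum p _ hs, mul_add, Finset.sum_add_distrib]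

theorem expect_const {p : PMF α} (hp : p.support.Finite) (k : ℝ) :
    expect p (fun _ => k) = k := by
  have hs : p.support ⊆ hp.toFinset := by simp
  rw [expect_eq_sum p _ hs, ← Finset.sum_mul, sum_toReal_eq_one p hs, one_mul]

theorem expect_const_mul (p : PMF α) (k : ℝ) (f : α → ℝ) :
    expect p (fun a => k * f a) = k * expect p f := by
  simp only [expect, ← tsum_mul_left]
  exact tsum_congr fun a => by ring

theorem expect_sum {p : PMF α} (hp : p.support.Finite) {ι : Type*} (s : Finset ι)
    (f : ι → α → ℝ) : expect p (fun a => ∑ i ∈ s, f i a) = ∑ i ∈ s, expect p (f i) := by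
  have hs : p.support ⊆ hp.toFinset := by simp
  simp only [expect_eq_sum p _ hs, Finset.mul_sum]
  exact Finset.sum_comm

theorem finite_support_bind {p : PMF α} (hp : p.support.Finite) {q : α → PMF β}
    (hq : ∀ a, (q a).support.Finite) : (p.bind q).support.Finite := by
  rw [PMF.support_bind]
  exact hp.biUnion fun a _ => hq a

theorem finite_support_map {p : PMF α} (hp : p.support.Finite) (f : α → β) :
    (p.map f).support.Finite := by
  rw [PMF.support_map]
  exact hp.image f

theorem expect_bind {p : PMF α} (hp : p.support.Finite) {q : α → PMF β}
    (hq : ∀ a, (q a).support.Finite) (g : β → ℝ) :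
    expect (p.bind q) g = expect p fun a => expect (q a) g := by
  classical
  have hs : p.support ⊆ hp.toFinset := by simp
  have hbf := finite_support_bind hp hq
  set u : Finset β := hp.toFinset.biUnion fun a => (hq a).toFinset
  have hu : ∀ a ∈ hp.toFinset, (q a).support ⊆ u := fun a ha b hb => by
    simp only [u, Finset.coe_biUnion, Set.mem_iUnion]
    exact ⟨a, ha, by simpa using hb⟩
  have hb : (p.bind q).support ⊆ u := by
    rw [PMF.support_bind]
    exact Set.iUnion₂_subset fun a ha => hu a (by simpa using ha)
  rw [expect_eq_sum _ g hb, expect_eq_sum p _ hs]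
  have h1 : ∀ b, ((p.bind q) b).toReal = ∑ a ∈ hp.toFinset, (p a).toReal * (q a b).toReal := by
    intro b
    rw [PMF.bind_apply, tsum_eq_sum (s := hp.toFinset), ENNReal.toReal_sum]
    · simp [ENNReal.toReal_mul]
    · exact fun a _ => ENNReal.mul_ne_top (p.apply_ne_top a) ((q a).apply_ne_top b)
    · intro a ha
      have : p a = 0 := by
        by_contra h
        exact ha (hs ((PMF.mem_support_iff p a).2 h))
      simp [this]
  simp only [h1, Finset.sum_mul]
  rw [Finset.sum_comm]
  refine Finset.sum_congr rfl fun a ha => ?_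
  rw [expect_eq_sum (q a) g (hu a ha), Finset.mul_sum]
  exact Finset.sum_congr rfl fun b _ => by ring

theorem expect_map {p : PMF α} (hp : p.support.Finite) (f : α → β) (g : β → ℝ) :
    expect (p.map f) g = expect p fun a => g (f a) := by
  rw [← PMF.bind_pure_comp, expect_bind hp]
  · congr 1
    funext a
    rw [expect_eq_sum (s := {f a}) _ _ (by simp)]
    simp
  · intro a
    simp

/-- Hoeffding's lemma for a distribution on `[0,1]`. -/
theorem expect_exp_le {p : PMF ℝ} (hp : p.support.Finite) (h01 : p.support ⊆ Set.Icc 0 1)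
    (l : ℝ) : expect p (fun v => Real.exp (l * (v - expect p id) - l ^ 2 / 8)) ≤ 1 := by
  have hae : ∀ᵐ v ∂p.toMeasure, v ∈ p.support := by
    rw [MeasureTheory.ae_iff]
    have : {a | a ∉ p.support} = p.supportᶜ := rfl
    rw [this, PMF.toMeasure_apply_eq_zero_iff _ hp.measurableSet.compl]
    exact disjoint_compl_right
  have hint : ∀ f : ℝ → ℝ, Measurable f → MeasureTheory.Integrable f p.toMeasure := by
    intro f hf
    obtain ⟨B, hB⟩ := (hp.image fun v => ‖f v‖).bddAbove
    refine MeasureTheory.Integrable.of_bound hf.aestronglyMeasurable B ?_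
    filter_upwards [hae] with v hv
    exact hB ⟨v, hv, rfl⟩
  have hE : ∀ f : ℝ → ℝ, Measurable f → ∫ v, f v ∂p.toMeasure = expect p f := by
    intro f hf
    rw [PMF.integral_eq_tsum _ _ (hint f hf)]
    rfl
  have hH := ProbabilityTheory.hasSubgaussianMGF_of_mem_Icc (μ := p.toMeasure) (X := id)
    (a := 0) (b := 1) measurable_id.aemeasurable (by filter_upwards [hae] with v hv using h01 hv)
  have hm := hH.mgf_le l
  simp only [ProbabilityTheory.mgf] at hm
  rw [hE id measurable_id, hE _ (by fun_prop)] at hm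
  have e : ∀ v : ℝ, Real.exp (l * (v - expect p id) - l ^ 2 / 8) =
      Real.exp (-(l ^ 2 / 8)) * Real.exp (l * (id v - expect p id)) := fun v => by
    rw [← Real.exp_add]; congr 1; simp only [id]; ring
  simp only [e]
  rw [expect_const_mul]
  -- The subgaussian parameter is `((1 - 0)/2)² = 1/4`, so the two exponents `± l²/8` cancel.
  refine (mul_le_mul_of_nonneg_left hm (Real.exp_pos _).le).trans ?_
  rw [← Real.exp_add]
  refine (Real.exp_le_exp.2 (le_of_eq ?_)).trans_eq Real.exp_zero
  simp
  ring

end Expectation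

/-! ### Samples per arm, and regrouping rounds by arm. -/

section Samples

variable {X : Type*}

theorem samples_cons_self (a : X) (v : ℝ) (h : History X) :
    samples ((a, v) :: h) a = v :: samples h a := by
  simp [samples]

theorem samples_cons_of_ne {a x : X} (hx : a ≠ x) (v : ℝ) (h : History X) :
    samples ((a, v) :: h) x = samples h x := by
  simp [samples, hx]

theorem samples_suffix {h' h : History X} (hs : h' <:+ h) (x : X) :
    samples h' x <:+ samples h x :=
  (hs.filter _).map _

open Classical in
/-- The arms played in a history. -/
def arms (h : History X) : Finset X := (h.map Prod.fst).toFinset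

open Classical in
theorem arms_cons (p : X × ℝ) (h : History X) : arms (p :: h) = insert p.1 (arms h) := by
  simp [arms]

theorem samples_eq_nil_iff {h : History X} {x : X} : samples h x = [] ↔ x ∉ arms h := by
  simp only [samples, arms, List.map_eq_nil_iff, List.filter_eq_nil_iff]
  simp only [decide_eq_true_eq, List.mem_toFinset, List.mem_map, not_exists, not_and]

theorem sum_map_fst_eq (h : History X) (f : X → ℝ) :
    (h.map fun p => f p.1).sum = ∑ x ∈ arms h, numPlays h x * f x := by
  classical
  have h1 : (h.map fun p => f p.1) = (h.map Prod.fst).map f := by simp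
  rw [h1, Finset.sum_list_map_count]
  refine Finset.sum_congr (by simp [arms]) fun x _ => ?_
  rw [nsmul_eq_mul, numPlays, samples, List.length_map, List.count, List.countP_map,
    List.countP_eq_length_filter]
  congr 4

theorem sum_numPlays (h : History X) : ∑ x ∈ arms h, (numPlays h x : ℝ) = h.length := by
  have := sum_map_fst_eq h fun _ => 1
  simpa using this.symm

end Samples

/-! ### Stopped exponential supermartingales and their sum over the played arms. -/

section Weight

/-- The exponential supermartingale with parameter `l` of a list of samples (most recent first) of
mean `m`, stopped after `n` samples. -/
def weight (l m : ℝ) (n : ℕ) : List ℝ → ℝ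
  | [] => 1
  | v :: L => weight l m n L * if L.length < n then Real.exp (l * (v - m) - l ^ 2 / 8) else 1

variable {l m : ℝ} {n : ℕ}

theorem weight_pos (L : List ℝ) : 0 < weight l m n L := by
  induction L with
  | nil => simp [weight]
  | cons v L ih =>
    rw [weight]
    split_ifs <;> positivity

theorem weight_of_length_le {L : List ℝ} (hL : L.length ≤ n) :
    weight l m n L = Real.exp (l * (L.sum - L.length * m) - L.length * (l ^ 2 / 8)) := by
  induction L with
  | nil => simp [weight]
  | cons v L ih =>
    simp only [List.length_cons] at hL
    rw [weight, if_pos (by omega), ih (by omega), ← Real.exp_add]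
    congr 1
    simp only [List.sum_cons, List.length_cons]
    push_cast
    ring

/-- Later samples contribute a factor 1. The final history therefore still shows a deviation that
occurred when the arm had exactly `n` samples. -/
theorem weight_of_suffix {L' L : List ℝ} (hs : L' <:+ L) (hn : L'.length = n) :
    weight l m n L = weight l m n L' := by
  obtain ⟨K, rfl⟩ := hs
  induction K with
  | nil => rfl
  | cons v K ih => simp [weight, ih, hn]

end Weight

section Potential

variable {X : Type*} [MetricSpace X] (I : Problem X)

/-- The sum of the weights of the arms played in a history. -/
def potential (l : ℝ) (n : ℕ) (h : History X) : ℝ :=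
  ∑ x ∈ arms h, weight l (I.mean x) n (samples h x)

variable {I}

theorem potential_nonneg (l : ℝ) (n : ℕ) (h : History X) : 0 ≤ potential I l n h :=
  Finset.sum_nonneg fun _ _ => (weight_pos _).le

theorem expect_weight_cons_le (hI : ∀ x, (I.reward x).support.Finite) (l : ℝ) (n : ℕ) (a : X)
    (L : List ℝ) :
    expect (I.reward a) (fun v => weight l (I.mean a) n (v :: L)) ≤ weight l (I.mean a) n L := by
  simp only [weight]
  rw [expect_const_mul]
  refine mul_le_of_le_one_right (weight_pos _).le ?_
  split_ifs
  · exact expect_exp_le (hI a) (I.reward_mem a) l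
  · exact (expect_const (hI a) 1).le

theorem expect_potential_cons_le (hI : ∀ x, (I.reward x).support.Finite) (l : ℝ) (n : ℕ) (a : X)
    (h : History X) :
    expect (I.reward a) (fun v => potential I l n ((a, v) :: h)) ≤ potential I l n h + 1 := by
  classical
  have h1 : ∀ v, potential I l n ((a, v) :: h) =
      weight l (I.mean a) n (v :: samples h a) +
        ∑ x ∈ (arms h).erase a, weight l (I.mean x) n (samples h x) := by
    intro v
    have hs : insert a (arms h) = insert a ((arms h).erase a) := by
      ext x; by_cases hx : x = a <;> simp [hx]
    rw [potential, arms_cons, hs, Finset.sum_insert (Finset.notMem_erase _ _), samples_cons_self]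
    congr 1
    refine Finset.sum_congr rfl fun x hx => ?_
    rw [samples_cons_of_ne (Finset.ne_of_mem_erase hx).symm]
  simp only [h1]
  rw [expect_add (hI a), expect_const (hI a)]
  have h2 := expect_weight_cons_le hI l n a (samples h a)
  -- Only an arm played for the first time brings a new summand, which starts from the weight 1 of
  -- the empty list.
  by_cases ha : a ∈ arms h
  · have := Finset.add_sum_erase (arms h) (fun x => weight l (I.mean x) n (samples h x)) ha
    simp only [potential]
    linarith
  · rw [samples_eq_nil_iff.2 ha] at h2 ⊢
    rw [Finset.erase_eq_of_notMem ha]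
    simp only [potential]
    have : weight l (I.mean a) n [] = 1 := rfl
    linarith

end Potential

/-! ### The law of the history. -/

section Law

variable {X : Type*} [MetricSpace X] {I : Problem X} (A : Algorithm X)

theorem finite_support_law (hI : ∀ x, (I.reward x).support.Finite) (t : ℕ) :
    (A.law I t).support.Finite := by
  induction t with
  | zero => simp [Algorithm.law]
  | succ t ih => exact finite_support_bind ih fun h => finite_support_map (hI _) _

theorem expect_law_succ (hI : ∀ x, (I.reward x).support.Finite) (t : ℕ) (g : History X → ℝ) :
    expect (A.law I (t + 1)) g =
      expect (A.law I t) fun h => expect (I.reward (A.play h)) fun v => g ((A.play h, v) :: h) := by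
  rw [Algorithm.law, expect_bind (finite_support_law A hI t) fun h => finite_support_map (hI _) _]
  simp only [expect_map (hI _)]

theorem expect_potential_le (hI : ∀ x, (I.reward x).support.Finite) (l : ℝ) (n t : ℕ) :
    expect (A.law I t) (potential I l n) ≤ t := by
  induction t with
  | zero =>
    rw [expect_eq_sum (s := {[]}) _ _ (by simp [Algorithm.law])]
    simp [Algorithm.law, potential, arms]
  | succ t ih =>
    rw [expect_law_succ A hI]
    have hf := finite_support_law A hI t
    refine (expect_mono hf fun h _ => expect_potential_cons_le hI l n (A.play h) h).trans ?_
    rw [expect_add hf, expect_const hf]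
    push_cast
    linarith

omit [MetricSpace X] in
/-- The histories that the algorithm can produce. -/
def Feasible : History X → Prop
  | [] => True
  | p :: h => p.1 = A.play h ∧ p.2 ∈ Set.Icc (0 : ℝ) 1 ∧ Feasible h

theorem feasible_of_mem_support_law (t : ℕ) {h : History X} (hh : h ∈ (A.law I t).support) :
    Feasible A h ∧ h.length = t := by
  induction t generalizing h with
  | zero =>
    obtain rfl : h = [] := by simpa [Algorithm.law] using hh
    simp [Feasible]
  | succ t ih =>
    rw [Algorithm.law, PMF.mem_support_bind_iff] at hh
    obtain ⟨h', hh', hv⟩ := hh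
    rw [PMF.mem_support_map_iff] at hv
    obtain ⟨v, hv, rfl⟩ := hv
    exact ⟨⟨rfl, I.reward_mem _ hv, (ih hh').1⟩, by simp [(ih hh').2]⟩

end Law

/-! ### Elementary bounds on means, gaps and confidence radii. -/

section Mean

variable {X : Type*} [MetricSpace X] {I : Problem X}

theorem mean_mem_Icc (hI : ∀ x, (I.reward x).support.Finite) (x : X) :
    I.mean x ∈ Set.Icc (0 : ℝ) 1 := by
  constructor
  · rw [← expect_const (hI x) 0]
    exact expect_mono (hI x) fun v hv => (I.reward_mem x hv).1
  · rw [← expect_const (hI x) 1]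
    exact expect_mono (hI x) fun v hv => (I.reward_mem x hv).2

theorem mean_le_best (hI : ∀ x, (I.reward x).support.Finite) (x : X) : I.mean x ≤ I.best :=
  le_ciSup (f := I.mean) ⟨1, by rintro _ ⟨y, rfl⟩; exact (mean_mem_Icc hI y).2⟩ x

theorem gap_nonneg (hI : ∀ x, (I.reward x).support.Finite) (x : X) : 0 ≤ I.gap x :=
  sub_nonneg.2 (mean_le_best hI x)

theorem gap_le_one [Nonempty X] (hI : ∀ x, (I.reward x).support.Finite) (x : X) :
    I.gap x ≤ 1 := by
  have h1 : I.best ≤ 1 := ciSup_le fun y => (mean_mem_Icc hI y).2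
  have h2 := (mean_mem_Icc hI x).1
  unfold Problem.gap
  linarith

end Mean

section Radius

variable {X : Type*} {T : ℕ}

theorem log_two_lt_log (hT : 2 ≤ T) : 0.69 < Real.log T := by
  have h1 : Real.log 2 ≤ Real.log T := Real.log_le_log (by norm_num) (by exact_mod_cast hT)
  have h2 := Real.log_two_gt_d9
  linarith

theorem confRadius_sq (hT : 2 ≤ T) (h : History X) (x : X) :
    confRadius T h x ^ 2 = 2 * Real.log T / (numPlays h x + 1) := by
  have := log_two_lt_log hT
  rw [confRadius, Real.sq_sqrt (by positivity)]

theorem confRadius_nonneg (h : History X) (x : X) : 0 ≤ confRadius T h x :=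
  Real.sqrt_nonneg _

theorem confRadius_of_numPlays_eq_zero (hT : 2 ≤ T) {h : History X} {x : X}
    (h0 : numPlays h x = 0) : 1.17 ≤ confRadius T h x := by
  have := log_two_lt_log hT
  refine Real.le_sqrt_of_sq_le ?_
  rw [h0]
  norm_num
  linarith

theorem avgReward_of_numPlays_eq_zero {h : History X} {x : X} (h0 : numPlays h x = 0) :
    avgReward h x = 0 := by
  simp [avgReward, h0]

theorem numPlays_le_length (h : History X) (x : X) : numPlays h x ≤ h.length := by
  rw [numPlays, samples, List.length_map]
  exact List.length_filter_le _ _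

end Radius

/-! ### Probability that the clean event fails. -/

section Clean

variable {X : Type*} [MetricSpace X] (I : Problem X) (T : ℕ)

/-- The clean event: in all rounds so far, all average rewards are within the confidence radius of
the mean rewards. -/
def Clean (h : History X) : Prop :=
  ∀ h', h' <:+ h → ∀ x, |avgReward h' x - I.mean x| ≤ confRadius T h' x

/-- A function of the history that is at least `1` outside of the clean event. -/
def failureBound (h : History X) : ℝ :=
  ∑ n ∈ Finset.Icc 1 T, Real.exp (-(4 * Real.log T * (n / (n + 1)))) *
    (potential I (4 * Real.sqrt (2 * Real.log T / (n + 1))) n h +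
      potential I (-(4 * Real.sqrt (2 * Real.log T / (n + 1)))) n h)

variable {I T}

theorem Clean.suffix {h h' : History X} (hc : Clean I T h) (hs : h' <:+ h) : Clean I T h' :=
  fun _ hs' => hc _ (hs'.trans hs)

theorem failureBound_nonneg (h : History X) : 0 ≤ failureBound I T h :=
  Finset.sum_nonneg fun _ _ => mul_nonneg (Real.exp_pos _).le
    (add_nonneg (potential_nonneg _ _ _) (potential_nonneg _ _ _))

/-- One arm with a large deviation makes the whole sum large, since all weights are positive and its
own weight is frozen after the samples in `h'`. -/
theorem le_potential {h h' : History X} (hs : h' <:+ h) {x : X} {l b : ℝ}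
    (h0 : numPlays h' x ≠ 0)
    (hb : b ≤ l * (numPlays h' x * (avgReward h' x - I.mean x)) - numPlays h' x * (l ^ 2 / 8)) :
    Real.exp b ≤ potential I l (numPlays h' x) h := by
  have hx : x ∈ arms h := by
    by_contra hx
    have := samples_suffix hs x
    rw [samples_eq_nil_iff.2 hx, List.suffix_nil] at this
    exact h0 (by simp [numPlays, this])
  have h1 := Finset.single_le_sum
    (f := fun y => weight l (I.mean y) (numPlays h' x) (samples h y))
    (fun _ _ => (weight_pos _).le) hx
  refine le_trans ?_ h1
  have hn : (samples h' x).length = numPlays h' x := rfl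
  rw [weight_of_suffix (samples_suffix hs x) hn, weight_of_length_le hn.le]
  refine Real.exp_le_exp.2 (hb.trans_eq ?_)
  have h2 : (numPlays h' x : ℝ) ≠ 0 := by exact_mod_cast h0
  have h3 : (samples h' x).sum = numPlays h' x * avgReward h' x := by
    rw [avgReward]
    field_simp
  rw [h3]
  simp only [numPlays]
  ring

theorem one_le_failureBound (hI : ∀ x, (I.reward x).support.Finite) (hT : 2 ≤ T)
    {h : History X} (hl : h.length ≤ T) (hc : ¬ Clean I T h) : 1 ≤ failureBound I T h := by
  unfold Clean at hc
  push Not at hc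
  obtain ⟨h', hs, x, hx⟩ := hc
  have hlog := log_two_lt_log hT
  -- An unplayed arm cannot violate cleanness: its average is 0 by convention, its mean at most 1,
  -- its radius above 1.
  have h0 : numPlays h' x ≠ 0 := by
    intro h0
    have h1 := confRadius_of_numPlays_eq_zero hT h0
    rw [avgReward_of_numPlays_eq_zero h0, zero_sub, abs_neg,
      abs_of_nonneg (mean_mem_Icc hI x).1] at hx
    have := (mean_mem_Icc hI x).2
    linarith
  set n := numPlays h' x with hn
  have hnT : n ≤ T := ((numPlays_le_length h' x).trans hs.length_le).trans hl
  have hn0 : (0 : ℝ) < n := by exact_mod_cast Nat.pos_of_ne_zero h0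
  set ρ := Real.sqrt (2 * Real.log T / (n + 1)) with hρ
  have hρ0 : 0 ≤ ρ := Real.sqrt_nonneg _
  have hρ2 : 4 * Real.log T * (n / (n + 1)) = 2 * n * ρ ^ 2 := by
    rw [hρ, Real.sq_sqrt (by positivity)]
    ring
  have hx' : ρ < |avgReward h' x - I.mean x| := hx
  -- The parameter `l = 4ρ` maximises `l n ρ - n l²/8`, with value `2nρ²`; the two signs handle the
  -- two tails.
  have key : Real.exp (4 * Real.log T * (n / (n + 1))) ≤
      potential I (4 * ρ) n h + potential I (-(4 * ρ)) n h := by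
    rw [hρ2]
    rcases lt_abs.1 hx' with h1 | h1
    · refine (le_potential hs h0 ?_).trans (le_add_of_nonneg_right (potential_nonneg _ _ _))
      rw [← hn]
      have := mul_le_mul_of_nonneg_left h1.le (mul_nonneg hn0.le hρ0)
      nlinarith
    · refine (le_potential hs h0 ?_).trans (le_add_of_nonneg_left (potential_nonneg _ _ _))
      rw [← hn]
      have := mul_le_mul_of_nonneg_left h1.le (mul_nonneg hn0.le hρ0)
      nlinarith
  have hsum := Finset.single_le_sum (s := Finset.Icc 1 T)
    (f := fun n : ℕ => Real.exp (-(4 * Real.log T * (n / (n + 1)))) *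
      (potential I (4 * Real.sqrt (2 * Real.log T / (n + 1))) n h +
        potential I (-(4 * Real.sqrt (2 * Real.log T / (n + 1)))) n h))
    (fun n _ => mul_nonneg (Real.exp_pos _).le
      (add_nonneg (potential_nonneg _ _ _) (potential_nonneg _ _ _)))
    (Finset.mem_Icc.2 ⟨Nat.one_le_iff_ne_zero.2 h0, hnT⟩)
  refine le_trans ?_ hsum
  refine le_trans ?_ (mul_le_mul_of_nonneg_left key (Real.exp_pos _).le)
  rw [← Real.exp_add]
  simp

/-- The exponent `4n/(n+1)` is only 2 at `n = 1` but at least `8/3 > 5/2` afterwards, so the first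
term is split off and the other fewer than `T` terms are at most `T^(-5/2)` each. -/
theorem sum_exp_le (hT : 2 ≤ T) :
    ∑ n ∈ Finset.Icc 1 T, Real.exp (-(4 * Real.log T * ((n : ℝ) / (n + 1)))) ≤
      2 / (T * Real.sqrt T) := by
  have hlog := log_two_lt_log hT
  have hT0 : (0 : ℝ) < T := by positivity
  have hT1 : (1 : ℝ) ≤ T := by exact_mod_cast (by omega : 1 ≤ T)
  have hE : ∀ k : ℝ, Real.exp (-(Real.log T * k)) = (T : ℝ) ^ (-k) := fun k => by
    rw [Real.rpow_def_of_pos hT0]; congr 1; ring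
  have h32 : (T : ℝ) * Real.sqrt T = (T : ℝ) ^ (3 / 2 : ℝ) := by
    rw [Real.sqrt_eq_rpow, ← Real.rpow_one_add' hT0.le (by norm_num)]
    norm_num
  have h1 : Real.exp (-(4 * Real.log T * (((1 : ℕ) : ℝ) / ((1 : ℕ) + 1)))) ≤
      (T : ℝ) ^ (-(3 / 2) : ℝ) := by
    rw [← hE]
    refine Real.exp_le_exp.2 ?_
    norm_num
    linarith
  have h2 : ∀ n ∈ Finset.Icc 2 T, Real.exp (-(4 * Real.log T * ((n : ℝ) / (n + 1)))) ≤
      (T : ℝ) ^ (-(5 / 2) : ℝ) := by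
    intro n hn
    have hn2 : (2 : ℝ) ≤ n := by exact_mod_cast (Finset.mem_Icc.1 hn).1
    have : (5 / 8 : ℝ) ≤ n / (n + 1) := by
      rw [le_div_iff₀ (by positivity)]
      linarith
    rw [← hE]
    refine Real.exp_le_exp.2 ?_
    nlinarith
  have h3 := Finset.sum_le_card_nsmul _ _ _ h2
  rw [← Finset.insert_Icc_add_one_left_eq_Icc (by omega : 1 ≤ T), Finset.sum_insert (by simp)]
  have h4 : ((Finset.Icc 2 T).card : ℝ) ≤ T := by
    rw [Nat.card_Icc]
    exact_mod_cast (by omega)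
  have h5 : (T : ℝ) * (T : ℝ) ^ (-(5 / 2) : ℝ) = (T : ℝ) ^ (-(3 / 2) : ℝ) := by
    rw [← Real.rpow_one_add' hT0.le (by norm_num)]
    norm_num
  have h6 : 2 / (T * Real.sqrt T) = 2 * (T : ℝ) ^ (-(3 / 2) : ℝ) := by
    rw [h32, Real.rpow_neg hT0.le]
    rfl
  rw [h6]
  rw [nsmul_eq_mul] at h3
  have h7 := mul_le_mul_of_nonneg_right h4 (Real.rpow_nonneg hT0.le (-(5 / 2) : ℝ))
  norm_num at h1 h3 h5 h7 ⊢
  linarith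

theorem expect_failureBound_le (hI : ∀ x, (I.reward x).support.Finite) (hT : 2 ≤ T)
    (A : Algorithm X) : expect (A.law I T) (failureBound I T) ≤ 4 / Real.sqrt T := by
  have hf := finite_support_law A hI T
  have hT0 : (0 : ℝ) < T := by positivity
  unfold failureBound
  rw [expect_sum hf]
  have h1 : ∀ n ∈ Finset.Icc 1 T, expect (A.law I T) (fun h =>
      Real.exp (-(4 * Real.log T * ((n : ℝ) / (n + 1)))) *
      (potential I (4 * Real.sqrt (2 * Real.log T / (n + 1))) n h +
        potential I (-(4 * Real.sqrt (2 * Real.log T / (n + 1)))) n h)) ≤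
      Real.exp (-(4 * Real.log T * ((n : ℝ) / (n + 1)))) * (2 * T) := by
    intro n _
    rw [expect_const_mul, expect_add hf]
    refine mul_le_mul_of_nonneg_left ?_ (Real.exp_pos _).le
    have h2 := expect_potential_le A hI (4 * Real.sqrt (2 * Real.log T / (n + 1))) n T
    have h3 := expect_potential_le A hI (-(4 * Real.sqrt (2 * Real.log T / (n + 1)))) n T
    linarith
  refine (Finset.sum_le_sum h1).trans ?_
  rw [← Finset.sum_mul]
  refine (mul_le_mul_of_nonneg_right (sum_exp_le hT) (by positivity)).trans_eq ?_
  field_simp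
  norm_num

end Clean

/-! ### Behaviour of the zooming algorithm in the clean event. -/

section Zooming

variable {X : Type*} [MetricSpace X] {I : Problem X} {T : ℕ} {A : Algorithm X}

theorem active_subset_cons (hA : A.IsZooming T) (p : X × ℝ) (h : History X) :
    A.active h ⊆ A.active (p :: h) := by
  rcases hA.activate_next p h with ⟨y, -, hy⟩ | ⟨-, hy⟩ <;> simp [hy]

theorem arms_subset_active (hA : A.IsZooming T) {h : History X} (hF : Feasible A h) :
    (arms h : Set X) ⊆ A.active h := by
  induction h with
  | nil => simp [arms]
  | cons p h ih =>
    classical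
    rw [arms_cons, Finset.coe_insert, Set.insert_subset_iff]
    refine ⟨?_, (ih hF.2.2).trans (active_subset_cons hA p h)⟩
    rw [hF.1]
    exact active_subset_cons hA p h (hA.play_active h)

theorem mem_covered_iff {h : History X} {S : Set X} {y : X} :
    y ∈ covered T h S ↔ ∃ x ∈ S, dist y x ≤ confRadius T h x := by
  simp [covered]

/-- Played arms are active and lie in their own balls. -/
theorem numPlays_eq_zero_of_notMem_covered (hA : A.IsZooming T) {p : X × ℝ} {h : History X}
    (hF : Feasible A (p :: h)) {y : X} (hy : y ∉ covered T (p :: h) (A.active h)) :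
    numPlays (p :: h) y = 0 := by
  rw [numPlays, List.length_eq_zero_iff, samples_eq_nil_iff]
  intro hmem
  classical
  refine hy (mem_covered_iff.2 ⟨y, ?_, by simpa using confRadius_nonneg _ _⟩)
  rw [arms_cons, Finset.mem_insert] at hmem
  rcases hmem with rfl | hmem
  · rw [hF.1]
    exact hA.play_active h
  · exact arms_subset_active hA hF.2.2 hmem

/-- In each round, either an arm that has never been played is active, or all arms are covered. -/
theorem exists_unplayed_or_covered (hA : A.IsZooming T) {h : History X} (hF : Feasible A h) :
    (∃ y ∈ A.active h, numPlays h y = 0) ∨ covered T h (A.active h) = Set.univ := by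
  cases h with
  | nil =>
    rcases hA.activate_first with ⟨y, -, hy⟩ | ⟨h1, h2⟩
    · exact .inl ⟨y, by simp [hy], by simp [numPlays, samples]⟩
    · exact .inr (by rw [h2, h1])
  | cons p h =>
    rcases hA.activate_next p h with ⟨y, h1, hy⟩ | ⟨h1, h2⟩
    · exact .inl ⟨y, by simp [hy], numPlays_eq_zero_of_notMem_covered hA hF h1⟩
    · exact .inr (by rw [h2, h1])

/-- If all arms are covered, any `y` lies in the ball of an active `x`, so `μ(y) ≤ μ(x) + r(x) ≤
index x`, which is at most the winning index, itself at most `μ + 3r` of the played arm. One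
activation per round need not restore covering. But then an unplayed arm is active with index at
least `2.34`, so the winner has `1 + 3r ≥ 2.34`, and its gap is at most 1 anyway. -/
theorem gap_play_le [Nonempty X] (hI : ∀ x, (I.reward x).support.Finite) (hT : 2 ≤ T)
    (hA : A.IsZooming T) {h : History X} (hF : Feasible A h) (hc : Clean I T h) :
    I.gap (A.play h) ≤ 3 * confRadius T h (A.play h) := by
  have hca := abs_le.1 (hc h (List.suffix_refl h) (A.play h))
  rcases exists_unplayed_or_covered hA hF with ⟨y, hy, h0⟩ | hcov
  · have h1 := hA.play_max h y hy
    have h2 := confRadius_of_numPlays_eq_zero hT h0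
    have h3 := mean_mem_Icc hI (A.play h)
    have h4 := gap_le_one hI (A.play h)
    rw [index, index, avgReward_of_numPlays_eq_zero h0] at h1
    linarith [h3.1, h3.2]
  · have h1 : I.best ≤ I.mean (A.play h) + 3 * confRadius T h (A.play h) := by
      refine ciSup_le fun y => ?_
      obtain ⟨x, hx, hd⟩ := mem_covered_iff.1 (hcov ▸ Set.mem_univ y)
      have h2 := abs_le.1 (hc h (List.suffix_refl h) x)
      have h3 : |I.mean y - I.mean x| ≤ dist y x := I.lipschitz y x
      have h4 := hA.play_max h x hx
      rw [index, index] at h4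
      linarith [(abs_le.1 h3).2]
    unfold Problem.gap
    linarith

/-- Only a play of `x` changes the left side, and just before it `Δ(x)² ≤ 9 · 2 log T/(n+1)`, where
`n+1` is the new count. -/
theorem numPlays_mul_gap_sq_le [Nonempty X] (hI : ∀ x, (I.reward x).support.Finite) (hT : 2 ≤ T)
    (hA : A.IsZooming T) {h : History X} (hF : Feasible A h) (hc : Clean I T h) (x : X) :
    numPlays h x * I.gap x ^ 2 ≤ 18 * Real.log T := by
  have hlog := log_two_lt_log hT
  induction h with
  | nil =>
    simp [numPlays, samples]
    linarith
  | cons p h ih =>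
    have hc' := hc.suffix (List.suffix_cons p h)
    obtain ⟨a, v⟩ := p
    by_cases hx : a = x
    · subst hx
      have h1 := gap_play_le hI hT hA hF.2.2 hc'
      have h2 : a = A.play h := hF.1
      rw [← h2] at h1
      have h3 := pow_le_pow_left₀ (gap_nonneg hI a) h1 2
      rw [mul_pow, confRadius_sq hT] at h3
      have h4 : numPlays ((a, v) :: h) a = numPlays h a + 1 := by
        simp [numPlays, samples_cons_self]
      rw [h4]
      push_cast
      rw [← mul_div_assoc, le_div_iff₀ (by positivity)] at h3
      linarith
    · rw [numPlays, samples_cons_of_ne hx]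
      exact ih hF.2.2 hc'

theorem gap_le_sqrt_mul_confRadius [Nonempty X] (hI : ∀ x, (I.reward x).support.Finite)
    (hT : 2 ≤ T) (hA : A.IsZooming T) {h : History X} (hF : Feasible A h) (hc : Clean I T h)
    (x : X) : I.gap x ≤ Real.sqrt 18 * confRadius T h x := by
  have hr := confRadius_nonneg (T := T) h x
  refine abs_le_of_sq_le_sq' ?_ (by positivity) |>.2
  rw [mul_pow, Real.sq_sqrt (by norm_num), confRadius_sq hT, ← mul_div_assoc,
    le_div_iff₀ (by positivity)]
  -- The radius has `n+1` in place of `n`. The extra `Δ² ≤ 1` is absorbed by doubling `18 log T`,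
  -- hence the factor `√18`.
  have h1 := numPlays_mul_gap_sq_le hI hT hA hF hc x
  have h2 := log_two_lt_log hT
  have h3 := pow_le_one₀ (gap_nonneg hI x) (gap_le_one hI x) (n := 2)
  linarith

/-- In the clean event, arms with gap at least `g` are active only if they are far apart. -/
theorem lt_dist_of_mem_active [Nonempty X] (hI : ∀ x, (I.reward x).support.Finite)
    (hT : 2 ≤ T) (hA : A.IsZooming T) {h : History X} (hF : Feasible A h) (hc : Clean I T h)
    {g : ℝ} {x y : X} (hx : x ∈ A.active h) (hy : y ∈ A.active h) (hxy : x ≠ y)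
    (hgx : g ≤ I.gap x) (hgy : g ≤ I.gap y) : g < Real.sqrt 18 * dist x y := by
  -- Separation is established at activation, with the radii of that moment, and survives because
  -- distances do not change.
  have step : ∀ (h : History X) (S S' : Set X), Feasible A h → Clean I T h →
      Activates T h S S' →
      (∀ x ∈ S, ∀ y ∈ S, x ≠ y → g ≤ I.gap x → g ≤ I.gap y → g < Real.sqrt 18 * dist x y) →
      ∀ x ∈ S', ∀ y ∈ S', x ≠ y → g ≤ I.gap x → g ≤ I.gap y → g < Real.sqrt 18 * dist x y := by
    intro h S S' hF hc hS ih
    rcases hS with ⟨z, hz, rfl⟩ | ⟨-, rfl⟩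
    · have far : ∀ x ∈ S, g ≤ I.gap x → g < Real.sqrt 18 * dist z x := by
        intro x hx hg
        have h1 : confRadius T h x < dist z x := by
          by_contra hcon
          exact hz (mem_covered_iff.2 ⟨x, hx, not_lt.1 hcon⟩)
        have h2 := gap_le_sqrt_mul_confRadius hI hT hA hF hc x
        exact (hg.trans h2).trans_lt (mul_lt_mul_of_pos_left h1 (by positivity))
      rintro x (rfl | hx) y (rfl | hy) hxy hgx hgy
      · exact absurd rfl hxy
      · exact far y hy hgy
      · rw [dist_comm]
        exact far x hx hgx
      · exact ih x hx y hy hxy hgx hgy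
    · exact ih
  suffices H : ∀ x ∈ A.active h, ∀ y ∈ A.active h, x ≠ y → g ≤ I.gap x → g ≤ I.gap y →
      g < Real.sqrt 18 * dist x y from H x hx y hy hxy hgx hgy
  clear hx hy
  induction h with
  | nil => exact step [] ∅ _ hF hc hA.activate_first (by simp)
  | cons p h ih =>
    exact step _ _ _ hF hc (hA.activate_next p h) (ih hF.2.2 (hc.suffix (List.suffix_cons p h)))

end Zooming

/-! ### Packing bounds from the zooming dimension. -/

section Dimension

variable {X : Type*} [MetricSpace X] {I : Problem X}

theorem card_le_coveringNumber {ε : ℝ} {Y : Set X} {P : Finset X} (hP : (P : Set X) ⊆ Y)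
    (hsep : ∀ x ∈ P, ∀ y ∈ P, x ≠ y → ε < dist x y) (hε : 0 ≤ ε) :
    (P.card : ℕ∞) ≤ coveringNumber ε Y := by
  refine le_iInf₂ fun F hF => ?_
  have hex : ∀ x ∈ P, ∃ B ∈ F, x ∈ B := fun x hx => by
    have : x ∈ ⋃₀ (F : Set (Set X)) := hF.1 ▸ hP hx
    simpa using this
  choose! f hfF hxf using hex
  refine Nat.cast_le.2 (Finset.card_le_card_of_injOn f (fun x hx => hfF x hx) ?_)
  intro x hx y hy hxy
  by_contra hne
  have h1 : edist x y ≤ ENNReal.ofReal ε :=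
    (Metric.edist_le_ediam_of_mem (hxf x hx) (hxy ▸ hxf y hy)).trans (hF.2 _ (hfF x hx))
  rw [edist_dist, ENNReal.ofReal_le_ofReal_iff hε] at h1
  exact absurd (hsep x hx y hy hne) (not_lt.2 h1)

theorem card_le_of_zoomingDim [Nonempty X] (hI : ∀ x, (I.reward x).support.Finite) {c : ℝ}
    (hc : 0 < c) {d : ℝ≥0} (hd : I.zoomingDim c = d) {r : ℝ} (hr : 0 < r) {P : Finset X}
    (hP : (P : Set X) ⊆ I.shell r) (hsep : ∀ x ∈ P, ∀ y ∈ P, x ≠ y → r / 3 < dist x y) :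
    (P.card : ℝ) ≤ c * r ^ (-(d : ℝ)) := by
  rcases P.eq_empty_or_nonempty with rfl | ⟨x, hx⟩
  · simp
    positivity
  have hr1 : r ≤ 1 := (hP hx).1.trans (gap_le_one hI x)
  -- The infimum need not be attained: the bound is proved for every `e > d`, raising an admissible
  -- exponent to `e` as `r ≤ 1` allows, and then `e` tends to `d`.
  have key : ∀ e : ℝ, (d : ℝ) < e → (P.card : ℝ) ≤ c * r ^ (-e) := by
    intro e he
    have he0 : 0 ≤ e := d.2.trans he.le
    lift e to ℝ≥0 using he0
    have h1 : I.zoomingDim c < e := by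
      rw [hd]
      exact_mod_cast he
    simp only [Problem.zoomingDim, iInf_lt_iff] at h1
    obtain ⟨e', he', h2⟩ := h1
    have h3 : (e' : ℝ) < e := by exact_mod_cast h2
    have h4 := (ENat.toENNReal_le.2 (card_le_coveringNumber hP hsep (by positivity))).trans
      (he' r hr)
    rw [ENat.toENNReal_coe, ← ENNReal.ofReal_natCast,
      ENNReal.ofReal_le_ofReal_iff (by positivity)] at h4
    refine h4.trans (mul_le_mul_of_nonneg_left ?_ hc.le)
    exact Real.rpow_le_rpow_of_exponent_ge hr hr1 (by linarith)
  have hcont : Filter.Tendsto (fun e : ℝ => c * r ^ (-e)) (nhdsWithin (d : ℝ) (Set.Ioi (d : ℝ)))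
      (nhds (c * r ^ (-(d : ℝ)))) := by
    have : Continuous fun e : ℝ => c * r ^ (-e) :=
      continuous_const.mul (Real.continuous_const_rpow hr.ne' |>.comp continuous_neg)
    exact this.continuousAt.tendsto.mono_left nhdsWithin_le_nhds
  exact ge_of_tendsto hcont (by filter_upwards [self_mem_nhdsWithin] with e he using key e he)

end Dimension

/-! ### Summing the regret over gap scales and taking expectations. -/

section Regret

variable {X : Type*} [MetricSpace X] {I : Problem X} {T : ℕ}

theorem regret_eq_sum {h : History X} (hl : h.length = T) :
    I.regret T h = ∑ x ∈ arms h, numPlays h x * I.gap x := by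
  rw [Problem.regret, sum_map_fst_eq, ← hl, ← sum_numPlays, Finset.mul_sum,
    ← Finset.sum_sub_distrib]
  refine Finset.sum_congr rfl fun x _ => ?_
  rw [Problem.gap]
  ring

theorem regret_le_mul {h : History X} (hl : h.length = T) {g : ℝ} (hg : ∀ x, I.gap x ≤ g) :
    I.regret T h ≤ g * T := by
  rw [regret_eq_sum hl, ← hl, ← sum_numPlays, Finset.mul_sum]
  refine Finset.sum_le_sum fun x _ => ?_
  rw [mul_comm]
  exact mul_le_mul_of_nonneg_right (hg x) (Nat.cast_nonneg _)

theorem sum_three_quarters_pow_le (N : ℕ) : ∑ i ∈ Finset.range N, (3 / 4 : ℝ) ^ i ≤ 4 := by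
  rw [geom_sum_eq (by norm_num), div_le_iff_of_neg (by norm_num)]
  have : (0 : ℝ) ≤ (3 / 4) ^ N := by positivity
  linarith

theorem four_thirds_le_sqrt_two : (4 / 3 : ℝ) ≤ Real.sqrt 2 :=
  Real.le_sqrt_of_sq_le (by norm_num)

variable [Nonempty X]

/-- The regret caused by the arms with gap in `[√2 r, 2 r)`. -/
theorem sum_shell_le (hI : ∀ x, (I.reward x).support.Finite) (hT : 2 ≤ T) {A : Algorithm X}
    (hA : A.IsZooming T) {c : ℝ} (hc : 0 < c) {d : ℝ≥0} (hd : I.zoomingDim c = d)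
    {h : History X} (hF : Feasible A h) (hcl : Clean I T h) {r : ℝ} (hr : 0 < r) {P : Finset X}
    (hP : P ⊆ arms h) (hPr : ∀ x ∈ P, Real.sqrt 2 * r ≤ I.gap x ∧ I.gap x < 2 * r) :
    ∑ x ∈ P, numPlays h x * I.gap x ≤ 18 * (c * Real.log T) * r ^ (-((d : ℝ) + 1)) := by
  have hlog := log_two_lt_log hT
  have h2 := four_thirds_le_sqrt_two
  have hge : ∀ x ∈ P, r ≤ I.gap x := fun x hx => by nlinarith [(hPr x hx).1]
  -- Gaps of at least `√2 r` give separation `√2 r/√18 = r/3`, exactly the covering scale. This is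
  -- why only the upper half of the shell, on a logarithmic scale, is used.
  have h18 : Real.sqrt 18 = 3 * Real.sqrt 2 := by
    rw [show (18 : ℝ) = 3 ^ 2 * 2 by norm_num, Real.sqrt_mul (by norm_num),
      Real.sqrt_sq (by norm_num)]
  have hcard : (P.card : ℝ) ≤ c * r ^ (-(d : ℝ)) := by
    refine card_le_of_zoomingDim hI hc hd hr (fun x hx => ⟨hge x hx, (hPr x hx).2⟩) ?_
    intro x hx y hy hxy
    have h3 := lt_dist_of_mem_active hI hT hA hF hcl (arms_subset_active hA hF (hP hx))
      (arms_subset_active hA hF (hP hy)) hxy (hPr x hx).1 (hPr y hy).1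
    rw [h18] at h3
    have h4 : Real.sqrt 2 * r < Real.sqrt 2 * (3 * dist x y) := by linarith
    have := lt_of_mul_lt_mul_left h4 (by positivity)
    linarith
  have hterm : ∀ x ∈ P, numPlays h x * I.gap x ≤ 18 * Real.log T / r := by
    intro x hx
    rw [le_div_iff₀ hr]
    have h3 := numPlays_mul_gap_sq_le hI hT hA hF hcl x
    refine le_trans ?_ h3
    rw [sq, ← mul_assoc]
    exact mul_le_mul_of_nonneg_left (hge x hx)
      (mul_nonneg (Nat.cast_nonneg _) (gap_nonneg hI x))
  refine (Finset.sum_le_card_nsmul _ _ _ hterm).trans ?_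
  rw [nsmul_eq_mul]
  refine (mul_le_mul_of_nonneg_right hcard (by positivity)).trans_eq ?_
  rw [neg_add, Real.rpow_add hr, Real.rpow_neg_one]
  ring

theorem regret_le_of_clean (hI : ∀ x, (I.reward x).support.Finite) (hT : 2 ≤ T)
    {A : Algorithm X} (hA : A.IsZooming T) {c : ℝ} (hc : 0 < c) {d : ℝ≥0}
    (hd : I.zoomingDim c = d) {h : History X} (hF : Feasible A h) (hcl : Clean I T h)
    (hl : h.length = T) {δ : ℝ} (hδ : 0 < δ) :
    I.regret T h ≤ 2 * δ * T + 72 * (c * Real.log T) * δ ^ (-((d : ℝ) + 1)) := by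
  classical
  have hlog := log_two_lt_log hT
  have h2 := four_thirds_le_sqrt_two
  have h2' : Real.sqrt 2 * Real.sqrt 2 = 2 := Real.mul_self_sqrt (by norm_num)
  have h22 : Real.sqrt 2 ≤ 2 := by nlinarith
  rw [regret_eq_sum hl, ← Finset.sum_filter_add_sum_filter_not (arms h)
    fun x => I.gap x < Real.sqrt 2 * δ]
  refine add_le_add ?_ ?_
  · rw [← hl, ← sum_numPlays, Finset.mul_sum]
    refine (Finset.sum_le_sum (g := fun x => 2 * δ * (numPlays h x : ℝ)) fun x hx => ?_).trans
      (Finset.sum_le_sum_of_subset_of_nonneg (Finset.filter_subset _ _)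
        fun x _ _ => by positivity)
    rw [mul_comm]
    refine mul_le_mul_of_nonneg_right ?_ (Nat.cast_nonneg _)
    nlinarith [(Finset.mem_filter.1 hx).2]
  · set H := (arms h).filter fun x => ¬ I.gap x < Real.sqrt 2 * δ with hH
    -- The scales `r = δ √2^i` grow by `√2`, so the intervals `[√2 r, 2r)` tile all gaps from `√2 δ`
    -- upwards.
    have hlevel : ∀ x ∈ H, ∃ i : ℕ, Real.sqrt 2 ^ i ≤ I.gap x / (Real.sqrt 2 * δ) ∧
        I.gap x / (Real.sqrt 2 * δ) < Real.sqrt 2 ^ (i + 1) := fun x hx => by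
      refine exists_nat_pow_near ?_ (by linarith)
      rw [one_le_div (by positivity)]
      exact not_lt.1 (Finset.mem_filter.1 hx).2
    choose! j hj using hlevel
    rw [← Finset.sum_fiberwise_of_maps_to (g := j) (t := Finset.range (H.sup j + 1))
      fun x hx => Finset.mem_range.2 (Nat.lt_succ_of_le (Finset.le_sup hx))]
    have hfib : ∀ i ∈ Finset.range (H.sup j + 1),
        ∑ x ∈ H.filter (fun x => j x = i), numPlays h x * I.gap x ≤
          18 * (c * Real.log T) * δ ^ (-((d : ℝ) + 1)) * (3 / 4) ^ i := by
      intro i _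
      have hr : 0 < δ * Real.sqrt 2 ^ i := by positivity
      refine (sum_shell_le hI hT hA hc hd hF hcl hr
        ((Finset.filter_subset _ _).trans (Finset.filter_subset _ _)) ?_).trans ?_
      · intro x hx
        obtain ⟨hxH, rfl⟩ := Finset.mem_filter.1 hx
        obtain ⟨h3, h4⟩ := hj x hxH
        rw [le_div_iff₀ (by positivity)] at h3
        rw [div_lt_iff₀ (by positivity), pow_succ] at h4
        constructor
        · linarith
        · refine h4.trans_eq ?_
          linear_combination (Real.sqrt 2 ^ j x * δ) * h2'
      · rw [Real.mul_rpow hδ.le (by positivity), ← mul_assoc]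
        refine mul_le_mul_of_nonneg_left ?_ (by positivity)
        -- Even for `d = 0` the factor `√2^(-(d+1))` is at most `1/√2 ≤ 3/4`, so the series
        -- converges with sum at most 4.
        have h5 : 1 ≤ Real.sqrt 2 ^ i := one_le_pow₀ (by linarith)
        refine (Real.rpow_le_rpow_of_exponent_le h5
          (by linarith [d.2] : -((d : ℝ) + 1) ≤ -1)).trans ?_
        rw [Real.rpow_neg_one, ← inv_pow]
        refine pow_le_pow_left₀ (by positivity) ?_ i
        rw [inv_le_comm₀ (by positivity) (by positivity)]
        linarith
    refine (Finset.sum_le_sum hfib).trans ?_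
    rw [← Finset.mul_sum]
    refine (mul_le_mul_of_nonneg_left (sum_three_quarters_pow_le _) (by positivity)).trans_eq ?_
    ring

/-- An arm of gap `g > 0` makes the shell at `r = g` nonempty, so `1 ≤ c g^(-d)`. With `g ≤ 1` this
gives `(g/2)^(d+2) ≤ c/4 ≤ c log T`, and `√T ≤ T^((d+1)/(d+2))`. -/
theorem gap_le_of_zoomingDim (hI : ∀ x, (I.reward x).support.Finite) (hT : 2 ≤ T) {c : ℝ}
    (hc : 0 < c) {d : ℝ≥0} (hd : I.zoomingDim c = d) (x : X) :
    I.gap x ≤ 2 * ((T : ℝ) ^ (((d : ℝ) + 1) / ((d : ℝ) + 2)) *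
      (c * Real.log T) ^ (1 / ((d : ℝ) + 2))) / Real.sqrt T := by
  have hlog := log_two_lt_log hT
  have hd0 : (0 : ℝ) ≤ d := d.2
  have hT1 : (1 : ℝ) ≤ T := by exact_mod_cast (by omega : 1 ≤ T)
  rcases (gap_nonneg hI x).eq_or_lt with h0 | h0
  · rw [← h0]
    positivity
  set g := I.gap x with hg
  have hg1 : g ≤ 1 := gap_le_one hI x
  have h1 : (1 : ℝ) ≤ c * g ^ (-(d : ℝ)) := by
    have := card_le_of_zoomingDim hI hc hd h0 (P := {x})
      (by simp [Problem.shell, ← hg, h0]) (by simp)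
    simpa using this
  have h2 : g ^ (d : ℝ) ≤ c := by
    rw [Real.rpow_neg h0.le, ← div_eq_mul_inv, one_le_div (by positivity)] at h1
    exact h1
  have h3 : (g / 2) ^ ((d : ℝ) + 2) ≤ c * Real.log T := by
    have h4 : g ^ ((d : ℝ) + 2) ≤ c :=
      (Real.rpow_le_rpow_of_exponent_ge h0 hg1 (by linarith)).trans h2
    have h5 : (1 / 2 : ℝ) ^ ((d : ℝ) + 2) ≤ 1 / 4 := by
      refine (Real.rpow_le_rpow_of_exponent_ge (by norm_num) (by norm_num)
        (by linarith : (2 : ℝ) ≤ (d : ℝ) + 2)).trans_eq ?_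
      norm_num
    rw [div_eq_mul_one_div, Real.mul_rpow h0.le (by norm_num)]
    exact mul_le_mul h4 (h5.trans (by linarith)) (by positivity) hc.le
  have h6 : g / 2 ≤ (c * Real.log T) ^ (1 / ((d : ℝ) + 2)) := by
    rw [one_div]
    exact (Real.le_rpow_inv_iff_of_pos (by positivity) (by positivity) (by positivity)).2 h3
  have h7 : Real.sqrt T ≤ (T : ℝ) ^ (((d : ℝ) + 1) / ((d : ℝ) + 2)) := by
    rw [Real.sqrt_eq_rpow]
    refine Real.rpow_le_rpow_of_exponent_le hT1 ?_
    rw [div_le_div_iff₀ (by norm_num) (by positivity)]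
    linarith
  rw [le_div_iff₀ (by positivity)]
  have := mul_le_mul h7 h6 (by positivity) (by positivity)
  linarith

/-- The witness `δ = (c log T / T)^(1/(d+2))` equates both terms of `regret_le_of_clean` up to
constants. -/
theorem exists_scale (hT : 2 ≤ T) {c : ℝ} (hc : 0 < c) (d : ℝ≥0) :
    ∃ δ : ℝ, 0 < δ ∧
      δ * T = (T : ℝ) ^ (((d : ℝ) + 1) / ((d : ℝ) + 2)) *
        (c * Real.log T) ^ (1 / ((d : ℝ) + 2)) ∧
      c * Real.log T * δ ^ (-((d : ℝ) + 1)) = δ * T := by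
  have hlog := log_two_lt_log hT
  have hd0 : (0 : ℝ) ≤ d := d.2
  have hT0 : (0 : ℝ) < T := by positivity
  have hL : 0 < c * Real.log T := by positivity
  have hδ : 0 < (c * Real.log T / T) ^ (1 / ((d : ℝ) + 2)) := by positivity
  refine ⟨_, hδ, ?_, ?_⟩
  · have h1 : ((d : ℝ) + 1) / ((d : ℝ) + 2) = 1 - 1 / ((d : ℝ) + 2) := by
      field_simp
      ring
    rw [h1, Real.rpow_sub hT0, Real.rpow_one, Real.div_rpow hL.le hT0.le]
    field_simp
  · set δ := (c * Real.log T / T) ^ (1 / ((d : ℝ) + 2)) with hδe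
    have h2 : δ ^ ((d : ℝ) + 2) = c * Real.log T / T := by
      rw [hδe, one_div, Real.rpow_inv_rpow (by positivity) (by positivity)]
    have h3 : c * Real.log T = δ ^ ((d : ℝ) + 2) * T := by
      rw [h2]
      field_simp
    rw [h3, mul_right_comm, ← Real.rpow_add hδ]
    have h4 : (d : ℝ) + 2 + -((d : ℝ) + 1) = 1 := by ring
    rw [h4, Real.rpow_one]

theorem expectedRegret_le (hI : ∀ x, (I.reward x).support.Finite) (hT : 2 ≤ T)
    {A : Algorithm X} (hA : A.IsZooming T) {c : ℝ} (hc : 0 < c) {d : ℝ≥0}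
    (hd : I.zoomingDim c = d) :
    A.expectedRegret I T ≤ 82 * ((T : ℝ) ^ (((d : ℝ) + 1) / ((d : ℝ) + 2)) *
      (c * Real.log T) ^ (1 / ((d : ℝ) + 2))) := by
  obtain ⟨δ, hδ, h1, h2⟩ := exists_scale hT hc d
  have hgap := gap_le_of_zoomingDim hI hT hc hd
  rw [← h1] at hgap ⊢
  have hT0 : (0 : ℝ) < T := by positivity
  have hf := finite_support_law A hI T
  -- Here `74 = 2 + 72` is the clean part; the failure part adds 8 in expectation, for a total of
  -- 82.
  have key : ∀ h ∈ (A.law I T).support,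
      I.regret T h ≤ 74 * (δ * T) + 2 * (δ * T) / Real.sqrt T * T * failureBound I T h := by
    intro h hh
    obtain ⟨hF, hl⟩ := feasible_of_mem_support_law A T hh
    by_cases hcl : Clean I T h
    · have h3 := regret_le_of_clean hI hT hA hc hd hF hcl hl hδ
      have h4 : 0 ≤ 2 * (δ * T) / Real.sqrt T * T * failureBound I T h :=
        mul_nonneg (by positivity) (failureBound_nonneg h)
      linarith
    · have h3 := regret_le_mul hl hgap
      have h4 := one_le_failureBound hI hT hl.le hcl
      have h5 : 0 ≤ 2 * (δ * T) / Real.sqrt T * T := by positivity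
      have h6 := mul_le_mul_of_nonneg_left h4 h5
      have h7 : 0 ≤ δ * T := by positivity
      linarith
  refine (expect_mono hf key).trans ?_
  rw [expect_add hf, expect_const hf, expect_const_mul]
  have h3 := mul_le_mul_of_nonneg_left (expect_failureBound_le hI hT A)
    (by positivity : 0 ≤ 2 * (δ * T) / Real.sqrt T * T)
  have h4 : 2 * (δ * T) / Real.sqrt T * T * (4 / Real.sqrt T) = 8 * (δ * T) := by
    have h5 : Real.sqrt T * Real.sqrt T = T := Real.mul_self_sqrt hT0.le
    field_simp
    rw [sq, h5]
    ring
  linarith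

end Regret

end LipMAB

end

/-- The regret of the zooming algorithm, with a constant `C` that depends on nothing. -/
theorem mainTheorem5 :
    ∃ C : ℝ, 0 < C ∧
      ∀ (X : Type*) [MetricSpace X] [Nonempty X] (I : LipMAB.Problem X) (V : Set ℝ),
        V.Finite → (∀ x, (I.reward x).support ⊆ V) →
        ∀ (T : ℕ), 2 ≤ T →
        ∀ (A : LipMAB.Algorithm X), A.IsZooming T →
        ∀ (c : ℝ), 0 < c → ∀ (d : ℝ≥0), I.zoomingDim c = (d : ℝ≥0∞) →
          A.expectedRegret I T ≤
            C * ((T : ℝ) ^ (((d : ℝ) + 1) / ((d : ℝ) + 2)) *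
              (c * Real.log T) ^ (1 / ((d : ℝ) + 2))) := by
  refine ⟨82, by norm_num, ?_⟩
  intro X _ _ I V hV hIV T hT A hA c hc d hd
  exact LipMAB.expectedRegret_le (fun x => hV.subset (hIV x)) hT hA hc hd
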